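/- **Setting.** Consider a Generic Second Order traffic Model with velocity $V(\rho,w)$ and flux $Q(\rho,w)=\rho V(\rho,w)$ for $w\in[w_L,w_R]$, $0\le\rho\le\rho^{\max}(w)$, where $V$ is $C^1$ up to the boundary of this domain, $\rho^{\max}$ is positive and continuous, $Q(\rho^{\max}(w),w)=0$, $\partial_\rho^2Q<0$, $\partial_wQ\ge 0$, $V\ge0$, $\partial_\rho V<0$, $\partial_wV\ge0$. Let $\sigma(w)$ be the maximum point of $Q(\cdot,w)$ and $\lambda_1=V+\rho\,\partial_\rho V$. Put $$C_*:=2\sup\Big(-\frac{\partial_wV(\rho,w)}{\partial_\rho V(\rho',w')}\Big)V(\rho'',w'),$$ the supremum being over all $(\rho,w),(\rho',w'),(\rho'',w')$ in the domain. Consider a wave-front tracking solution on an incoming road $[a,b]$, $-\infty\le a<b<\infty$, of a junction $J$ located at $x=b$. Its fronts $\Sigma=(U^-,U^+)$, $U^\pm=(\rho^\pm,w^\pm)$, are $\rho$-waves ($w^-=w^+$), which are shocks ($\rho^-<\rho^+$, Rankine–Hugoniot speed) or rarefaction fronts ($\rho^->\rho^+$, speed in $[\lambda_1(U^-),\lambda_1(U^+)]$),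 and $w$-waves ($w^-\ne w^+$, $V(U^-)=V(U^+)$, speed $V(U^-)$). Inside the road fronts interact two at a time; the outcome is a $\rho$-wave followed by a $w$-wave (either may be trivial). At any time the junction may send into the road a shock of negative speed or a rarefaction, split into finitely many fronts, with nonpositive characteristic speeds, all its fronts having negative speed. For a front $\Sigma$ let $\delta_-Q_\Sigma=Q(\rho^-,w^-)-Q(\rho^+,w^+)$. Its *backward wave tree* consists of all fronts met when tracing it back through its interactions to the boundary of $[a,b]\times[0,\infty)$; its *backward branch* is the part reached through fronts of its own family only. A *returning wave* $\Sigma^R$ with absorption time $t_a$ and original time $t_o$ is a front that reaches $J$ at time $t_a$ with positive speed and whose backward branch contains a front emitted by $J$ before $t_a$; $t_o<t_a$ is the greatest time at which a front of its backward branch was emitted by $J$. Fronts of the tree of $\Sigma^R$ travelling at time $t_o$ have level $1$ (as have fronts entering later from the left end of the road); an interaction of a front of level $k$ with a $w$-wave generates fronts of level $k+1$; an interaction of two $\rho$-waves generates a front whose level is the maximum of their levels. $K$ is the maximal level in the tree, $w^k$ is the value of $w$ on the front of level $k$ in the history of $\Sigma^R$ (followed through the right mothers), and $TV^K_{tree}=\sum_{k=2}^K|w^k-w^{k-1}|$.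 **Proposition.** Let $\Sigma^R=(U^{R,-},U^{R,+})$ with $w^{R,-}=w^{R,+}=:w^R$ be a returning wave on the incoming road, with original time $t_o$ and absorption time $t_a$. When used below, $\widetilde\rho^{R,-}\in[0,\rho^{\max}(w^R)]$ satisfies $Q(\widetilde\rho^{R,-},w^R)=Q(\rho^{R,-},w^R)$. 1. If (a) $\Sigma^R$ is a shock, or (b) $\Sigma^R$ is a rarefaction with $\widetilde\rho^{R,-}<\rho^{R,+}<\sigma(w^R)<\rho^{R,-}$, or (c) the backward wave tree of $\Sigma^R$ contains only $\rho$-waves, then $\delta_-Q_{\Sigma^R}<0$. 2. If $\Sigma^R$ is a rarefaction with $\rho^{R,+}<\widetilde\rho^{R,-}<\sigma(w^R)<\rho^{R,-}$ generated by the interaction of a $w$-wave $\Sigma^\ell=(U^{0,-},U^{0,+})$ (on the left) with a $\rho$-wave $\Sigma^r$ (on the right) emitted by $J$ at time $t_o$, then $$0<\delta_-Q_{\Sigma^R}<C_*\,|w^{0,+}-w^{0,-}|.$$ 3. If $\Sigma^R$ is a rarefaction with $\delta_-Q_{\Sigma^R}>0$, then $$\delta_-Q_{\Sigma^R}\le C_*\,TV^K_{tree}+\sum_{\Sigma}[\delta_-Q_{\Sigma}]_+,$$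 the sum being over the $\rho$-waves $\Sigma$ of level $1$ travelling at time $t_o$ in the backward wave tree, and $[\cdot]_+$ denoting the positive part. -/

import Mathlib

/-! ## The traffic model -/

/-- A state `U = (ρ, w)`: density and driver attribute. -/
@[ext] structure TState where
  rho : ℝ
  w : ℝ

/-- A Generic Second Order traffic Model, given by its velocity function `V(ρ, w)`, the interval
`[wL, wR]` of the attribute, and the maximal density `ρ^max(w)`. The flux is `Q(ρ, w) = ρ V(ρ, w)`;
all conditions are required on the physical domain `wL ≤ w ≤ wR`, `0 ≤ ρ ≤ ρ^max(w)`. -/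
structure GSOM where
  V : ℝ → ℝ → ℝ
  wL : ℝ
  wR : ℝ
  rhoMax : ℝ → ℝ
  wL_le_wR : wL ≤ wR
  rhoMax_pos : ∀ w ∈ Set.Icc wL wR, 0 < rhoMax w
  rhoMax_cont : ContinuousOn rhoMax (Set.Icc wL wR)
  /-- `V` is continuously differentiable up to the boundary of the physical domain. -/
  smooth : ∃ O : Set (ℝ × ℝ), IsOpen O ∧
    (∀ w ∈ Set.Icc wL wR, ∀ ρ ∈ Set.Icc 0 (rhoMax w), (ρ, w) ∈ O) ∧
    ContDiffOn ℝ 1 (fun p : ℝ × ℝ => V p.1 p.2) O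
  /-- The flux vanishes at the maximal density (it vanishes at `ρ = 0` because `Q = ρ V`). -/
  flux_rhoMax : ∀ w ∈ Set.Icc wL wR, rhoMax w * V (rhoMax w) w = 0
  /-- `∂²Q/∂ρ² < 0`. -/
  flux_concave : ∀ w ∈ Set.Icc wL wR, ∀ ρ ∈ Set.Ioo 0 (rhoMax w),
    deriv (deriv fun r => r * V r w) ρ < 0
  /-- `∂Q/∂w ≥ 0`. -/
  flux_mono : ∀ w ∈ Set.Icc wL wR, ∀ ρ ∈ Set.Icc 0 (rhoMax w), 0 ≤ deriv (fun u => ρ * V ρ u) w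
  V_nonneg : ∀ w ∈ Set.Icc wL wR, ∀ ρ ∈ Set.Icc 0 (rhoMax w), 0 ≤ V ρ w
  /-- `∂V/∂ρ < 0`. -/
  V_rho_neg : ∀ w ∈ Set.Icc wL wR, ∀ ρ ∈ Set.Icc 0 (rhoMax w), deriv (fun r => V r w) ρ < 0
  /-- `∂V/∂w ≥ 0`. -/
  V_w_nonneg : ∀ w ∈ Set.Icc wL wR, ∀ ρ ∈ Set.Icc 0 (rhoMax w), 0 ≤ deriv (fun u => V ρ u) w

namespace GSOM

/-- The flux `Q(ρ, w) = ρ V(ρ, w)`. -/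
def Q (M : GSOM) (ρ w : ℝ) : ℝ := ρ * M.V ρ w

/-- The partial derivative `∂V/∂ρ`. -/
noncomputable def Vrho (M : GSOM) (ρ w : ℝ) : ℝ := deriv (fun r => M.V r w) ρ

/-- The partial derivative `∂V/∂w`. -/
noncomputable def Vw (M : GSOM) (ρ w : ℝ) : ℝ := deriv (fun u => M.V ρ u) w

/-- The physical domain. -/
def Dom (M : GSOM) (ρ w : ℝ) : Prop := w ∈ Set.Icc M.wL M.wR ∧ ρ ∈ Set.Icc 0 (M.rhoMax w)

/-- The critical density `σ(w)`: the point where `Q(·, w)` attains its maximum on `[0, ρ^max(w)]`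
(unique, by strict concavity). -/
noncomputable def sigma (M : GSOM) (w : ℝ) : ℝ :=
  sSup {ρ | ρ ∈ Set.Icc 0 (M.rhoMax w) ∧ ∀ r ∈ Set.Icc 0 (M.rhoMax w), M.Q r w ≤ M.Q ρ w}

/-- The first characteristic speed `λ₁ = V + ρ ∂V/∂ρ`. -/
noncomputable def lam1 (M : GSOM) (U : TState) : ℝ :=
  M.V U.rho U.w + U.rho * M.Vrho U.rho U.w

/-- `C_* = 2 sup (- ∂_w V(ρ, w) / ∂_ρ V(ρ', w')) V(ρ'', w')`, the supremum being over all densities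
and attributes such that `(ρ, w)`, `(ρ', w')` and `(ρ'', w')` lie in the physical domain. -/
noncomputable def Cstar (M : GSOM) : ℝ :=
  2 * sSup {c | ∃ ρ ρ' ρ'' w w' : ℝ, M.Dom ρ w ∧ M.Dom ρ' w' ∧ M.Dom ρ'' w' ∧
    c = -(M.Vw ρ w / M.Vrho ρ' w') * M.V ρ'' w'}

end GSOM

/-! ## Wave fronts together with their genealogy -/

/-- The three ways in which a front can enter the domain `road × [0, ∞)` through its boundary: at
time `0`, through the left end of the road, or from the junction (the right end of the road). -/
inductive WaveSource
  | start
  | inflow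
  | junction

/-- A wave front `Σ = (U⁻, U⁺)` travelling with constant speed `s` from the point `x` where it is
born at time `t`, together with its history: either it entered through the boundary of the domain,
or it was generated by the interaction of a left mother `l` and a right mother `r`. -/
inductive Wave
  | source (k : WaveSource) (Um Up : TState) (s x t : ℝ)
  | daughter (l r : Wave) (Um Up : TState) (s x t : ℝ)

namespace Wave

/-- Left state. -/
def left : Wave → TState
  | source _ Um _ _ _ _ => Um
  | daughter _ _ Um _ _ _ _ => Um

/-- Right state. -/
def right : Wave → TState
  | source _ _ Up _ _ _ => Up
  | daughter _ _ _ Up _ _ _ => Up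

def speed : Wave → ℝ
  | source _ _ _ s _ _ => s
  | daughter _ _ _ _ s _ _ => s

def birthPos : Wave → ℝ
  | source _ _ _ _ x _ => x
  | daughter _ _ _ _ _ x _ => x

def birthTime : Wave → ℝ
  | source _ _ _ _ _ t => t
  | daughter _ _ _ _ _ _ t => t

/-- Position at time `t`. -/
def pos (S : Wave) (t : ℝ) : ℝ := S.birthPos + S.speed * (t - S.birthTime)

/-- The front entered the domain through the part `k` of the boundary, at the point `x` and the
time `t`. -/
def EntersAt (S : Wave) (k : WaveSource) (x t : ℝ) : Prop :=
  ∃ Um Up s, S = source k Um Up s x t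

/-- The front originated from the junction at time `t`. -/
def FromJunction (S : Wave) (t : ℝ) : Prop := ∃ x, S.EntersAt WaveSource.junction x t

/-- `ρ`-waves: `w` is conserved. All other fronts are `w`-waves. -/
def IsRho (S : Wave) : Prop := S.left.w = S.right.w

/-- A `ρ`-wave that is a shock. -/
def IsShock (S : Wave) : Prop := S.IsRho ∧ S.left.rho < S.right.rho

/-- A `ρ`-wave that is a rarefaction front. -/
def IsRarefaction (S : Wave) : Prop := S.IsRho ∧ S.right.rho < S.left.rho

open Classical in
/-- The backward wave tree: all fronts, of both families, met when tracing the front back in time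
through its interactions to the boundary of the domain. -/
noncomputable def tree : Wave → Finset Wave
  | S@(source _ _ _ _ _ _) => {S}
  | S@(daughter l r _ _ _ _ _) => insert S (tree l ∪ tree r)

/-- The backward wave branch: the part of the backward tree reached through fronts of the family of
the given front only. -/
inductive InBranch (R : Wave) : Wave → Prop
  | refl : InBranch R R
  | left {l r : Wave} {Um Up : TState} {s x t : ℝ} :
      InBranch R (daughter l r Um Up s x t) → (l.IsRho ↔ R.IsRho) → InBranch R l
  | right {l r : Wave} {Um Up : TState} {s x t : ℝ} :
      InBranch R (daughter l r Um Up s x t) → (r.IsRho ↔ R.IsRho) → InBranch R r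

open Classical in
/-- The fronts of the backward wave tree that are travelling at time `t₀`, i.e. born at or before
`t₀` and still alive just after `t₀` (a mother dies when its daughters are born). -/
noncomputable def aliveAt (t₀ : ℝ) : Wave → Finset Wave
  | S@(source _ _ _ _ _ t) => if t ≤ t₀ then {S} else ∅
  | S@(daughter l r _ _ _ _ t) => if t ≤ t₀ then {S} else aliveAt t₀ l ∪ aliveAt t₀ r

open Classical in
/-- Level of a front with respect to the time `t₀`. Fronts travelling at time `t₀` have level `1`;
an interaction of a front of level `k` with a `w`-wave generates fronts of level `k + 1`; an
interaction of `ρ`-waves does not change the level. -/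
noncomputable def level (t₀ : ℝ) : Wave → ℕ
  | source _ _ _ _ _ _ => 1
  | daughter l r _ _ _ _ t =>
      if t ≤ t₀ then 1
      else if ¬ l.IsRho then level t₀ r + 1
      else if ¬ r.IsRho then level t₀ l + 1
      else max (level t₀ l) (level t₀ r)

/-- The order `K`: the maximal level in the backward wave tree. -/
noncomputable def order (t₀ : ℝ) (R : Wave) : ℕ := R.tree.sup (level t₀)

open Classical in
/-- The value `w^k` of `w` on the front of level `k` in the history of a `ρ`-wave. The history is
followed through the right mothers: these are always `ρ`-waves, and since `w`-waves overtake
`ρ`-waves from the left, a right mother has met every `w`-wave that its left sister has met, so that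
every level occurs along this line. -/
noncomputable def levelW (t₀ : ℝ) : Wave → ℕ → ℝ
  | source _ Um _ _ _ _, _ => Um.w
  | S@(daughter _ r Um _ _ _ t), k => if t ≤ t₀ ∨ level t₀ S ≤ k then Um.w else levelW t₀ r k

/-- `TV_tree^K = ∑_{k=2}^K |w^k - w^{k-1}|`. -/
noncomputable def TVtree (t₀ : ℝ) (R : Wave) : ℝ :=
  ∑ k ∈ Finset.Icc 2 (order t₀ R), |levelW t₀ R k - levelW t₀ R (k - 1)|

open Classical in
/-- The `ρ`-waves of level `1` at time `t₀` in the backward wave tree. -/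
noncomputable def levelOne (t₀ : ℝ) (R : Wave) : Finset Wave := {S ∈ aliveAt t₀ R | S.IsRho}

/-- Consecutive fronts `ws`, listed from left to right, fit together when `U₀` is the state to the
left of all of them. -/
def Linked : TState → List Wave → Prop
  | _, [] => True
  | U₀, f :: ws => f.left = U₀ ∧ Linked f.right ws

/-- The state to the right of all the fronts `ws`, if `U₀` is the state to the left of them. -/
def endState : TState → List Wave → TState
  | U₀, [] => U₀
  | _, f :: ws => endState f.right ws

/-- At time `t` the fronts are inside the road `[a, b]` and ordered from left to right. -/
def InOrder (a : EReal) (b t : ℝ) (ws : List Wave) : Prop :=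
  ws.Pairwise (fun f g => f.pos t ≤ g.pos t) ∧ ∀ f ∈ ws, a ≤ (f.pos t : EReal) ∧ f.pos t ≤ b

end Wave

/-! ## Wave-front tracking on an incoming road -/

namespace GSOM

/-- The backward flux variation `δ₋Q_Σ = Q(U⁻) - Q(U⁺)`. -/
def dQminus (M : GSOM) (S : Wave) : ℝ :=
  M.Q S.left.rho S.left.w - M.Q S.right.rho S.right.w

/-- Admissible fronts: shocks with the Rankine-Hugoniot speed, rarefaction fronts with a speed
between the characteristic speeds of their two states, and `w`-waves (contact discontinuities),
across which `w` jumps, the velocity `V` is conserved, and which travel with this velocity. -/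
def IsFront (M : GSOM) (S : Wave) : Prop :=
  M.Dom S.left.rho S.left.w ∧ M.Dom S.right.rho S.right.w ∧
  ((S.IsShock ∧ S.speed = (M.Q S.right.rho S.right.w - M.Q S.left.rho S.left.w) /
      (S.right.rho - S.left.rho)) ∨
   (S.IsRarefaction ∧ M.lam1 S.left ≤ S.speed ∧ S.speed ≤ M.lam1 S.right) ∨
   (¬ S.IsRho ∧ M.V S.left.rho S.left.w = M.V S.right.rho S.right.w ∧
      S.speed = M.V S.left.rho S.left.w))

/-- The fronts `es` sent into the incoming road by the junction at `(b, t)` when the state in front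
of the junction is `U`: they solve a Riemann problem with left state `U` by a wave of negative
speed, namely a shock of negative speed, or a rarefaction, split into finitely many fronts, whose
characteristic speeds are nonpositive (no wave at all if `es = []`). -/
def IsEmission (M : GSOM) (U : TState) (b t : ℝ) (es : List Wave) : Prop :=
  Wave.Linked U es ∧
  (∀ e ∈ es, M.IsFront e ∧ e.EntersAt WaveSource.junction b t ∧ e.speed < 0) ∧
  ((∃ e, es = [e] ∧ e.IsShock) ∨ (∀ e ∈ es, e.IsRarefaction ∧ M.lam1 e.right ≤ 0)) ∧
  es.Pairwise (fun e e' => e.speed < e'.speed)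

open Classical in
/-- The fronts generated at `(x, t)` by the interaction of `f` (left) and `g` (right), if `Us` is
the middle state of the Riemann problem: a `ρ`-wave `(f⁻, Us)` followed by a `w`-wave `(Us, g⁺)`,
where trivial waves are left out. -/
noncomputable def outgoing (f g : Wave) (Us : TState) (s₁ s₂ x t : ℝ) : List Wave :=
  (if f.left = Us then [] else [Wave.daughter f g f.left Us s₁ x t]) ++
  (if Us = g.right then [] else [Wave.daughter f g Us g.right s₂ x t])

/-- `M.Tracking a b t U₀ ws`: the wave-front tracking algorithm on the incoming road `[a, b]`
(`a = -∞` is allowed), whose right end `b` is the junction, can reach at time `t` the piecewise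
constant profile with left-most state `U₀` and fronts `ws`, listed from left to right. Between two
events the fronts move with their constant speeds and stay ordered.

The junction is arbitrary (any number of roads, any Riemann solver): at any time it may send waves
of negative speed into the road. -/
inductive Tracking (M : GSOM) (a : EReal) (b : ℝ) : ℝ → TState → List Wave → Prop
  /-- Time `0`: the initial Riemann problems inside the road have been solved. -/
  | start (U₀ : TState) (ws : List Wave)
      (hU : M.Dom U₀.rho U₀.w)
      (hlink : Wave.Linked U₀ ws)
      (hws : ∀ f ∈ ws, M.IsFront f ∧ ∃ x : ℝ, a < (x : EReal) ∧ x < b ∧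
        f.EntersAt WaveSource.start x 0)
      (hord : ws.Pairwise fun f g =>
        f.birthPos < g.birthPos ∨ (f.birthPos = g.birthPos ∧ f.speed < g.speed)) :
      Tracking M a b 0 U₀ ws
  /-- Two neighbouring fronts, and no others, meet inside the road; the new Riemann problem is
  solved. -/
  | interaction {t : ℝ} {U₀ : TState} {pre post : List Wave} {f g : Wave}
      (h : Tracking M a b t U₀ (pre ++ f :: g :: post))
      (t' x : ℝ) (ht : t ≤ t')
      (hord : Wave.InOrder a b t' (pre ++ f :: g :: post))
      (hax : a < (x : EReal)) (hxb : x < b)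
      (hf : f.pos t' = x) (hg : g.pos t' = x) (hspeed : g.speed < f.speed)
      (hother : ∀ e ∈ pre ++ post, e.pos t' ≠ x)
      (Us : TState) (s₁ s₂ : ℝ)
      (hUs : M.Dom Us.rho Us.w) (hw : Us.w = f.left.w)
      (hV : M.V Us.rho Us.w = M.V g.right.rho g.right.w)
      (hout : ∀ e ∈ outgoing f g Us s₁ s₂ x t', M.IsFront e) :
      Tracking M a b t' U₀ (pre ++ outgoing f g Us s₁ s₂ x t' ++ post)
  /-- Event at the junction: possibly the last front reaches the junction and is absorbed, then
  waves may be sent into the road. -/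
  | junction {t : ℝ} {U₀ : TState} {ws arr : List Wave}
      (h : Tracking M a b t U₀ (ws ++ arr))
      (t' : ℝ) (ht : t ≤ t')
      (hord : Wave.InOrder a b t' (ws ++ arr))
      (harr : arr = [] ∨ ∃ R, arr = [R] ∧ R.pos t' = b ∧ 0 < R.speed)
      (es : List Wave)
      (hes : M.IsEmission (Wave.endState U₀ ws) b t' es) :
      Tracking M a b t' U₀ (ws ++ es)
  /-- Event at the left end of the road: possibly the first front leaves the road, then waves may
  enter. -/
  | inflow {t : ℝ} {U₀ : TState} {dep ws : List Wave}
      (h : Tracking M a b t U₀ (dep ++ ws))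
      (t' x : ℝ) (ht : t ≤ t')
      (hord : Wave.InOrder a b t' (dep ++ ws))
      (hx : (x : EReal) = a)
      (hdep : dep = [] ∨ ∃ f, dep = [f] ∧ f.pos t' = x ∧ f.speed < 0)
      (U₁ : TState) (ins : List Wave)
      (hU₁ : M.Dom U₁.rho U₁.w)
      (hlink : Wave.Linked U₁ ins)
      (hend : Wave.endState U₁ ins = Wave.endState U₀ dep)
      (hins : ∀ f ∈ ins, M.IsFront f ∧ f.EntersAt WaveSource.inflow x t' ∧ 0 < f.speed)
      (hspeed : ins.Pairwise fun f g => f.speed < g.speed) :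
      Tracking M a b t' U₁ (ins ++ ws)

/-- `R` is a returning wave on the incoming road `[a, b]` with original time `t_o` and absorption
time `t_a`: a front of a wave-front tracking solution which reaches the junction at time `t_a`, and
`t_o < t_a` is the greatest time at which a front of its backward branch originated from the
junction. -/
def IsReturningWave (M : GSOM) (a : EReal) (b : ℝ) (R : Wave) (t_o t_a : ℝ) : Prop :=
  (∃ (t : ℝ) (U₀ : TState) (ws : List Wave), M.Tracking a b t U₀ (ws ++ [R]) ∧ t ≤ t_a ∧
    Wave.InOrder a b t_a (ws ++ [R]) ∧ R.pos t_a = b ∧ 0 < R.speed) ∧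
  t_o < t_a ∧
  IsGreatest {t | ∃ S, R.InBranch S ∧ S.FromJunction t} t_o

end GSOM

/-!
The argument rests on a single estimate for a returning rarefaction `R`: its right state has the
same velocity as a congested state `U₀` (one with `σ(w₀) ≤ ρ₀`) with which the junction emitted the
rightmost ancestor of `R`, whence
`δ₋Q_R < (C_* / 2) |w^R - w₀|`  (`GSOM.IsReturningWave.dQminus_lt`).

*The ancestor.* No front moves faster than the velocity `V` of its right state, so that in every
interaction the right mother is a `ρ`-wave (`GSOM.IsFront.isRho_of_speed_lt`). Following the right
mothers of `R` back in time, the velocity of the right state never changes. Fronts never overtake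
each other without interacting, and the junction is the right end of the road; hence emissions are
ordered in time from left to right (`GSOM.Tracking.invariant`), and the line of right mothers enters
from the junction exactly at the original time `t_o` (`GSOM.IsReturningWave.rightSource`). What the
junction emits has negative speed, so its right state is congested
(`GSOM.IsEmission.isCongested`).

*The flux estimate* (`GSOM.IsCongested.flux_sub_lt`). Express the flux through the velocity `v` and
the attribute `w`. At the attribute `w₀` it is strictly increasing in `v` up to the velocity of
`U₀`, so the variation between the velocities of the two states of `R` is negative. At fixed `v` it
is nondecreasing in `w` with Lipschitz constant `C_* / 2` (`GSOM.flux_sub_mem_Icc`), which bounds the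
cost of passing from `w₀` to `w^R`. The Lipschitz bound comes from two applications of the mean
value theorem along a path in the physical domain; the path stays inside because `ρ^max` is
nondecreasing (`GSOM.rhoMax_monotoneOn`).

*Conclusion.* If the tree has only `ρ`-waves, then `w^R = w₀` and the estimate gives `δ₋Q_R < 0`. If
`R` comes from one interaction of a `w`-wave with an emitted front, then `|w^R - w₀|` is the jump of
that `w`-wave. In general `|w^R - w₀| = |w^K - w^1| ≤ TV_tree^K`, because along the line of right
mothers the attribute changes only together with the level; the contribution of the waves
travelling at `t_o` is nonnegative. The remaining cases, shocks and rarefactions with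
`ρ̃⁻ < ρ⁺ < σ < ρ⁻`, follow from the Rankine-Hugoniot condition and from the monotonicity of the flux
below `σ`.
-/

/-! ### Smoothness and monotonicity of the velocity -/

namespace GSOM

variable {M : GSOM} {ρ w : ℝ}

lemma Dom.contDiffAt (h : M.Dom ρ w) :
    ContDiffAt ℝ 1 (fun p : ℝ × ℝ => M.V p.1 p.2) (ρ, w) := by
  obtain ⟨O, hO, hmem, hc⟩ := M.smooth
  exact hc.contDiffAt (hO.mem_nhds (hmem w h.1 ρ h.2))

lemma Dom.hasFDerivAt (h : M.Dom ρ w) :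
    HasFDerivAt (fun p : ℝ × ℝ => M.V p.1 p.2)
      (fderiv ℝ (fun p : ℝ × ℝ => M.V p.1 p.2) (ρ, w)) (ρ, w) :=
  (h.contDiffAt.differentiableAt one_ne_zero).hasFDerivAt

lemma Dom.hasDerivAt_rho_fderiv (h : M.Dom ρ w) :
    HasDerivAt (fun r => M.V r w)
      (fderiv ℝ (fun p : ℝ × ℝ => M.V p.1 p.2) (ρ, w) (1, 0)) ρ :=
  h.hasFDerivAt.comp_hasDerivAt (f := fun r : ℝ => (r, w)) ρ ((hasDerivAt_id ρ).prodMk (hasDerivAt_const ρ w))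

lemma Dom.hasDerivAt_w_fderiv (h : M.Dom ρ w) :
    HasDerivAt (fun u => M.V ρ u)
      (fderiv ℝ (fun p : ℝ × ℝ => M.V p.1 p.2) (ρ, w) (0, 1)) w :=
  h.hasFDerivAt.comp_hasDerivAt (f := fun u : ℝ => (ρ, u)) w ((hasDerivAt_const w ρ).prodMk (hasDerivAt_id w))

lemma Dom.fderiv_rho (h : M.Dom ρ w) :
    fderiv ℝ (fun p : ℝ × ℝ => M.V p.1 p.2) (ρ, w) (1, 0) = M.Vrho ρ w :=
  h.hasDerivAt_rho_fderiv.deriv.symm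

lemma Dom.fderiv_w (h : M.Dom ρ w) :
    fderiv ℝ (fun p : ℝ × ℝ => M.V p.1 p.2) (ρ, w) (0, 1) = M.Vw ρ w :=
  h.hasDerivAt_w_fderiv.deriv.symm

lemma Dom.hasDerivAt_rho (h : M.Dom ρ w) : HasDerivAt (fun r => M.V r w) (M.Vrho ρ w) ρ :=
  h.fderiv_rho ▸ h.hasDerivAt_rho_fderiv

lemma Dom.hasDerivAt_w (h : M.Dom ρ w) : HasDerivAt (fun u => M.V ρ u) (M.Vw ρ w) w :=
  h.fderiv_w ▸ h.hasDerivAt_w_fderiv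

lemma Dom.Vrho_neg (h : M.Dom ρ w) : M.Vrho ρ w < 0 := M.V_rho_neg w h.1 ρ h.2

lemma Dom.Vw_nonneg (h : M.Dom ρ w) : 0 ≤ M.Vw ρ w := M.V_w_nonneg w h.1 ρ h.2

lemma Dom.V_nonneg (h : M.Dom ρ w) : 0 ≤ M.V ρ w := GSOM.V_nonneg M w h.1 ρ h.2

lemma dom_rhoMax (hw : w ∈ Set.Icc M.wL M.wR) : M.Dom (M.rhoMax w) w :=
  ⟨hw, (M.rhoMax_pos w hw).le, le_rfl⟩

lemma V_rhoMax (hw : w ∈ Set.Icc M.wL M.wR) : M.V (M.rhoMax w) w = 0 :=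
  (mul_eq_zero.1 (M.flux_rhoMax w hw)).resolve_left (M.rhoMax_pos w hw).ne'

lemma V_continuousOn (hw : w ∈ Set.Icc M.wL M.wR) :
    ContinuousOn (fun r => M.V r w) (Set.Icc 0 (M.rhoMax w)) := fun _ hr =>
  (Dom.hasDerivAt_rho (M := M) ⟨hw, hr⟩).continuousAt.continuousWithinAt

lemma V_strictAntiOn (hw : w ∈ Set.Icc M.wL M.wR) :
    StrictAntiOn (fun r => M.V r w) (Set.Icc 0 (M.rhoMax w)) :=
  strictAntiOn_of_deriv_neg (convex_Icc _ _) (V_continuousOn hw) fun r hr =>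
    M.V_rho_neg w hw r (interior_subset hr)

lemma exists_V_eq {v : ℝ} (h : M.Dom ρ w) (hv : v ∈ Set.Icc 0 (M.V ρ w)) :
    ∃ r, M.Dom r w ∧ ρ ≤ r ∧ M.V r w = v := by
  have hsub : Set.Icc ρ (M.rhoMax w) ⊆ Set.Icc 0 (M.rhoMax w) :=
    Set.Icc_subset_Icc_left h.2.1
  obtain ⟨r, hr, hrv⟩ := intermediate_value_Icc' h.2.2 ((V_continuousOn h.1).mono hsub)
    (by simpa [V_rhoMax h.1] using hv)
  exact ⟨r, ⟨h.1, hsub hr⟩, hr.1, hrv⟩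

/-- `ρ^max` is nondecreasing: it is the zero set of `V`, so that its slope is
`-∂_wV / ∂_ρV ≥ 0`. -/
lemma rhoMax_monotoneOn : MonotoneOn M.rhoMax (Set.Icc M.wL M.wR) := by
  intro w₁ hw₁ w₂ hw₂ h12
  have hsub : Set.Icc w₁ w₂ ⊆ Set.Icc M.wL M.wR := Set.Icc_subset_Icc hw₁.1 hw₂.2
  have key := image_le_of_liminf_slope_right_le_deriv_boundary
    (f := fun w => -M.rhoMax w) (a := w₁) (b := w₂) (B := fun _ => -M.rhoMax w₁)
    (B' := fun _ => 0) (M.rhoMax_cont.mono hsub).neg le_rfl continuousOn_const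
    (fun x _ => hasDerivWithinAt_const _ _ _) ?_ (x := w₂) ⟨h12, le_rfl⟩
  · simpa using key
  intro x hx r hr
  have hxD := hsub ⟨hx.1, hx.2.le⟩
  have hD := dom_rhoMax (M := M) hxD
  have hA : 0 < -M.Vrho (M.rhoMax x) x := neg_pos.2 hD.Vrho_neg
  set A := -M.Vrho (M.rhoMax x) x with hAdef
  have hδ : 0 < A * r / (2 * (1 + r)) := by positivity
  set δ := A * r / (2 * (1 + r)) with hδdef
  have hδr : δ * (1 + r) = A * r / 2 := by rw [hδdef]; field_simp
  have hcont : Filter.Tendsto (fun z => (M.rhoMax z, z)) (nhdsWithin x (Set.Ioo x w₂))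
      (nhds (M.rhoMax x, x)) :=
    (((M.rhoMax_cont x hxD).mono fun z hz => hsub ⟨hx.1.trans hz.1.le, hz.2.le⟩).prodMk
      continuousWithinAt_id).tendsto
  have hev := hcont.eventually (hD.hasFDerivAt.isLittleO.bound hδ)
  rw [← nhdsWithin_Ioo_eq_nhdsGT hx.2]
  have hne : (nhdsWithin x (Set.Ioo x w₂)).NeBot := by
    rw [nhdsWithin_Ioo_eq_nhdsGT hx.2]; infer_instance
  refine Filter.Eventually.frequently ?_
  filter_upwards [hev, self_mem_nhdsWithin] with z hz hzm
  have hzD := hsub ⟨hx.1.trans hzm.1.le, hzm.2.le⟩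
  have hpos : 0 < z - x := sub_pos.2 hzm.1
  have hlin : fderiv ℝ (fun p : ℝ × ℝ => M.V p.1 p.2) (M.rhoMax x, x)
      (M.rhoMax z - M.rhoMax x, z - x) =
      -A * (M.rhoMax z - M.rhoMax x) + M.Vw (M.rhoMax x) x * (z - x) := by
    have : ((M.rhoMax z - M.rhoMax x, z - x) : ℝ × ℝ) =
        (M.rhoMax z - M.rhoMax x) • (1, 0) + (z - x) • (0, 1) := by simp
    rw [this, map_add, map_smul, map_smul, hD.fderiv_rho, hD.fderiv_w, hAdef]
    simp only [smul_eq_mul]; ring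
  rw [Prod.mk_sub_mk, hlin] at hz
  simp only [V_rhoMax hzD, V_rhoMax hxD, sub_zero, zero_sub, norm_neg, Real.norm_eq_abs,
    Prod.norm_mk] at hz
  rw [slope_def_field, div_lt_iff₀ hpos]
  by_contra hcon
  push Not at hcon
  have hD0 : 0 < M.rhoMax x - M.rhoMax z := lt_of_lt_of_le (mul_pos hr hpos) (by linarith)
  have h1 := (le_abs_self _).trans hz
  rw [abs_of_neg (by linarith : M.rhoMax z - M.rhoMax x < 0), abs_of_pos hpos] at h1
  have hmax : max (-(M.rhoMax z - M.rhoMax x)) (z - x) ≤ M.rhoMax x - M.rhoMax z + (z - x) :=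
    max_le (by linarith) (by linarith)
  have h2 := h1.trans (mul_le_mul_of_nonneg_left hmax hδ.le)
  have h3 := mul_nonneg hD.Vw_nonneg hpos.le
  have h4 : r * (A * (M.rhoMax x - M.rhoMax z)) ≤
      r * (δ * (M.rhoMax x - M.rhoMax z + (z - x))) :=
    mul_le_mul_of_nonneg_left (by linarith) hr.le
  have h5 : δ * (r * (z - x)) ≤ δ * (M.rhoMax x - M.rhoMax z) :=
    mul_le_mul_of_nonneg_left (by linarith) hδ.le
  have h6 : 0 < A * r * (M.rhoMax x - M.rhoMax z) := by positivity
  have h7 : δ * (1 + r) * (M.rhoMax x - M.rhoMax z) =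
    A * r / 2 * (M.rhoMax x - M.rhoMax z) := by rw [hδr]
  linarith

lemma Dom.mono {w' : ℝ} (h : M.Dom ρ w) (hw : w ≤ w') (hw' : w' ≤ M.wR) : M.Dom ρ w' :=
  have hm : w' ∈ Set.Icc M.wL M.wR := ⟨h.1.1.trans hw, hw'⟩
  ⟨hm, h.2.1, h.2.2.trans (rhoMax_monotoneOn h.1 hm hw)⟩

/-! ### The constant `C_*` as a Lipschitz constant -/

lemma isCompact_dom : IsCompact {p : ℝ × ℝ | M.Dom p.1 p.2} := by
  have h : {p : ℝ × ℝ | M.Dom p.1 p.2} =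
      (fun q : ℝ × ℝ => (q.2 * M.rhoMax q.1, q.1)) ''
        (Set.Icc M.wL M.wR ×ˢ Set.Icc (0 : ℝ) 1) := by
    ext ⟨ρ, w⟩
    constructor
    · rintro ⟨hw, hρ⟩
      have hp := M.rhoMax_pos w hw
      exact ⟨(w, ρ / M.rhoMax w), ⟨hw, div_nonneg hρ.1 hp.le, (div_le_one hp).2 hρ.2⟩,
        by simp [hp.ne']⟩
    · rintro ⟨⟨u, s⟩, ⟨hu, hs⟩, heq⟩
      obtain ⟨rfl, rfl⟩ := Prod.mk.inj heq
      have hp := M.rhoMax_pos u hu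
      exact ⟨hu, mul_nonneg hs.1 hp.le, mul_le_of_le_one_left hp.le hs.2⟩
  rw [h]
  refine (isCompact_Icc.prod isCompact_Icc).image_of_continuousOn ?_
  exact (continuousOn_snd.mul (M.rhoMax_cont.comp continuousOn_fst fun q hq => hq.1)).prodMk
    continuousOn_fst

lemma continuousOn_fderiv_V :
    ContinuousOn (fderiv ℝ (fun p : ℝ × ℝ => M.V p.1 p.2)) {p | M.Dom p.1 p.2} :=
  fun _ hp => ((Dom.contDiffAt hp).continuousAt_fderiv one_ne_zero).continuousWithinAt

lemma bddAbove_Cstar : BddAbove {c | ∃ ρ ρ' ρ'' w w' : ℝ, M.Dom ρ w ∧ M.Dom ρ' w' ∧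
    M.Dom ρ'' w' ∧ c = -(M.Vw ρ w / M.Vrho ρ' w') * M.V ρ'' w'} := by
  have hr : ContinuousOn (fun p : ℝ × ℝ => (M.Vrho p.1 p.2)⁻¹) {p | M.Dom p.1 p.2} :=
    ContinuousOn.inv₀ ((continuousOn_fderiv_V.clm_apply continuousOn_const).congr
      fun p hp => (Dom.fderiv_rho hp).symm) fun p hp => (Dom.Vrho_neg hp).ne
  have hw : ContinuousOn (fun p : ℝ × ℝ => M.Vw p.1 p.2) {p | M.Dom p.1 p.2} :=
    (continuousOn_fderiv_V.clm_apply continuousOn_const).congr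
      fun p hp => (Dom.fderiv_w hp).symm
  have hV : ContinuousOn (fun p : ℝ × ℝ => M.V p.1 p.2) {p | M.Dom p.1 p.2} :=
    fun p hp => (Dom.contDiffAt hp).continuousAt.continuousWithinAt
  obtain ⟨A, hA⟩ := isCompact_dom.exists_bound_of_continuousOn hw
  obtain ⟨B, hB⟩ := isCompact_dom.exists_bound_of_continuousOn hr
  obtain ⟨C, hC⟩ := isCompact_dom.exists_bound_of_continuousOn hV
  refine ⟨A * B * C, ?_⟩
  rintro _ ⟨ρ, ρ', ρ'', w, w', h, h', h'', rfl⟩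
  have hA' := hA (ρ, w) h
  have hB' := hB (ρ', w') h'
  have hC' := hC (ρ'', w') h''
  have hA0 := (norm_nonneg _).trans hA'
  have hB0 := (norm_nonneg _).trans hB'
  calc -(M.Vw ρ w / M.Vrho ρ' w') * M.V ρ'' w'
      ≤ ‖-(M.Vw ρ w / M.Vrho ρ' w') * M.V ρ'' w'‖ := Real.le_norm_self _
    _ = ‖M.Vw ρ w‖ * ‖(M.Vrho ρ' w')⁻¹‖ * ‖M.V ρ'' w'‖ := by
        rw [div_eq_mul_inv, norm_mul, norm_neg, norm_mul]
    _ ≤ A * B * C := by gcongr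

lemma le_half_Cstar {ρ ρ' ρ'' w w' : ℝ} (h : M.Dom ρ w) (h' : M.Dom ρ' w')
    (h'' : M.Dom ρ'' w') : -(M.Vw ρ w / M.Vrho ρ' w') * M.V ρ'' w' ≤ M.Cstar / 2 := by
  have := le_csSup bddAbove_Cstar ⟨ρ, ρ', ρ'', w, w', h, h', h'', rfl⟩
  rw [Cstar]
  linarith

lemma Cstar_nonneg : 0 ≤ M.Cstar := by
  have hD := dom_rhoMax (M := M) ⟨le_rfl, M.wL_le_wR⟩
  have h := le_half_Cstar hD hD hD
  rw [V_rhoMax hD.1, mul_zero] at h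
  linarith

/-- For a fixed value `v` of the velocity, the flux `v ρ` is nondecreasing and Lipschitz as a
function of `w`, with constant `C_* / 2`. The mean value theorem is applied on the path
`(ρ₁, w₁) → (ρ₁, w₂) → (ρ₂, w₂)`, which stays in the domain because `ρ^max` is nondecreasing. -/
lemma flux_sub_mem_Icc {ρ₁ ρ₂ w₁ w₂ : ℝ} (h₁ : M.Dom ρ₁ w₁) (h₂ : M.Dom ρ₂ w₂)
    (hw : w₁ ≤ w₂) (hV : M.V ρ₁ w₁ = M.V ρ₂ w₂) :
    M.V ρ₂ w₂ * (ρ₂ - ρ₁) ∈ Set.Icc 0 (M.Cstar / 2 * (w₂ - w₁)) := by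
  have hcorner : M.Dom ρ₁ w₂ := h₁.mono hw h₂.1.2
  rcases hw.eq_or_lt with rfl | hlt
  · have := (V_strictAntiOn h₁.1).injOn h₁.2 h₂.2 hV
    simp [this]
  have hpath : ∀ u ∈ Set.Icc w₁ w₂, M.Dom ρ₁ u := fun u hu => h₁.mono hu.1 (hu.2.trans h₂.1.2)
  obtain ⟨ξ, hξ, hξeq⟩ := exists_hasDerivAt_eq_slope (fun u => M.V ρ₁ u) (fun u => M.Vw ρ₁ u) hlt
    (fun u hu => (hpath u hu).hasDerivAt_w.continuousAt.continuousWithinAt)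
    (fun u hu => (hpath u ⟨hu.1.le, hu.2.le⟩).hasDerivAt_w)
  have hξD := hpath ξ ⟨hξ.1.le, hξ.2.le⟩
  rw [eq_div_iff (sub_pos.2 hlt).ne'] at hξeq
  have hge : M.V ρ₂ w₂ ≤ M.V ρ₁ w₂ := by
    have := mul_nonneg hξD.Vw_nonneg (sub_pos.2 hlt).le
    linarith
  have hρ : ρ₁ ≤ ρ₂ := ((V_strictAntiOn h₂.1).le_iff_ge h₂.2 hcorner.2).1 hge
  refine ⟨mul_nonneg h₂.V_nonneg (sub_nonneg.2 hρ), ?_⟩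
  rcases hρ.eq_or_lt with rfl | hρlt
  · have := mul_nonneg (Cstar_nonneg (M := M)) (sub_pos.2 hlt).le
    rw [sub_self, mul_zero]
    linarith
  have hpath' : ∀ r ∈ Set.Icc ρ₁ ρ₂, M.Dom r w₂ := fun r hr =>
    ⟨h₂.1, h₁.2.1.trans hr.1, hr.2.trans h₂.2.2⟩
  obtain ⟨η, hη, hηeq⟩ := exists_hasDerivAt_eq_slope (fun r => M.V r w₂) (fun r => M.Vrho r w₂)
    hρlt (fun u hu => (hpath' u hu).hasDerivAt_rho.continuousAt.continuousWithinAt)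
    (fun u hu => (hpath' u ⟨hu.1.le, hu.2.le⟩).hasDerivAt_rho)
  have hηD := hpath' η ⟨hη.1.le, hη.2.le⟩
  rw [eq_div_iff (sub_pos.2 hρlt).ne'] at hηeq
  have hsum : M.Vrho η w₂ * (ρ₂ - ρ₁) = -(M.Vw ρ₁ ξ * (w₂ - w₁)) := by linarith
  have hdiff : ρ₂ - ρ₁ = -(M.Vw ρ₁ ξ / M.Vrho η w₂) * (w₂ - w₁) := by
    have := hηD.Vrho_neg.ne
    field_simp
    linarith
  calc M.V ρ₂ w₂ * (ρ₂ - ρ₁)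
      = -(M.Vw ρ₁ ξ / M.Vrho η w₂) * M.V ρ₂ w₂ * (w₂ - w₁) := by rw [hdiff]; ring
    _ ≤ M.Cstar / 2 * (w₂ - w₁) :=
        mul_le_mul_of_nonneg_right (le_half_Cstar hξD hηD h₂) (sub_pos.2 hlt).le

/-! ### Concavity of the flux -/

lemma Dom.hasDerivAt_Q (h : M.Dom ρ w) :
    HasDerivAt (fun r => M.Q r w) (M.lam1 ⟨ρ, w⟩) ρ := by
  have := (hasDerivAt_id' ρ).mul h.hasDerivAt_rho
  rw [one_mul] at this
  exact this

lemma Q_continuousOn (hw : w ∈ Set.Icc M.wL M.wR) :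
    ContinuousOn (fun r => M.Q r w) (Set.Icc 0 (M.rhoMax w)) := fun _ hr =>
  (Dom.hasDerivAt_Q (M := M) ⟨hw, hr⟩).continuousAt.continuousWithinAt

lemma Q_strictConcaveOn (hw : w ∈ Set.Icc M.wL M.wR) :
    StrictConcaveOn ℝ (Set.Icc 0 (M.rhoMax w)) (fun r => M.Q r w) := by
  refine strictConcaveOn_of_deriv2_neg (convex_Icc _ _) (Q_continuousOn hw) fun r hr => ?_
  rw [interior_Icc] at hr
  exact M.flux_concave w hw r hr

lemma sigma_isMaxOn (hw : w ∈ Set.Icc M.wL M.wR) :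
    M.sigma w ∈ Set.Icc 0 (M.rhoMax w) ∧
      IsMaxOn (fun r => M.Q r w) (Set.Icc 0 (M.rhoMax w)) (M.sigma w) := by
  obtain ⟨m, hm, hmax⟩ := isCompact_Icc.exists_isMaxOn
    (Set.nonempty_Icc.2 (M.rhoMax_pos w hw).le) (Q_continuousOn hw)
  have hset : {ρ | ρ ∈ Set.Icc 0 (M.rhoMax w) ∧ ∀ r ∈ Set.Icc 0 (M.rhoMax w),
      M.Q r w ≤ M.Q ρ w} = {m} := by
    ext r
    constructor
    · rintro ⟨hr, hrmax⟩
      exact (Q_strictConcaveOn hw).eq_of_isMaxOn (isMaxOn_iff.2 hrmax) hmax hr hm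
    · rintro rfl
      exact ⟨hm, isMaxOn_iff.1 hmax⟩
  have : M.sigma w = m := by rw [sigma, hset, csSup_singleton]
  exact this ▸ ⟨hm, hmax⟩

lemma Q_lt_of_lt_sigma {r r' : ℝ} (hr : M.Dom r w) (h : r < r') (h' : r' < M.sigma w) :
    M.Q r w < M.Q r' w := by
  obtain ⟨hσ, hmax⟩ := sigma_isMaxOn hr.1
  have := (Q_strictConcaveOn hr.1).lt_on_openSegment hr.2 hσ (h.trans h').ne
    (by rw [openSegment_eq_Ioo (h.trans h')]; exact ⟨h, h'⟩)
  rwa [min_eq_left (hmax hr.2)] at this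

end GSOM

/-! ### Congested states -/

namespace GSOM

variable {M : GSOM}

/-- A congested state: every larger density with the same attribute carries a smaller flux. This
says `σ(w) ≤ ρ` in the form in which it is used. -/
def IsCongested (M : GSOM) (U : TState) : Prop :=
  M.Dom U.rho U.w ∧ ∀ y, M.Dom y U.w → U.rho < y → M.Q y U.w < M.Q U.rho U.w

lemma isCongested_of_lam1_nonpos {U : TState} (hU : M.Dom U.rho U.w) (h : M.lam1 U ≤ 0) :
    M.IsCongested U := by
  refine ⟨hU, fun y hy hlt => ?_⟩
  have := (Q_strictConcaveOn hU.1).slope_lt_of_hasDerivAt hU.2 hy.2 hlt hU.hasDerivAt_Q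
  rw [slope_def_field, div_lt_iff₀ (sub_pos.2 hlt)] at this
  have h' : M.lam1 U * (y - U.rho) ≤ 0 := mul_nonpos_of_nonpos_of_nonneg h (sub_pos.2 hlt).le
  linarith

lemma isCongested_of_shock {U₁ U₂ : TState} (h₁ : M.Dom U₁.rho U₁.w) (h₂ : M.Dom U₂.rho U₂.w)
    (hw : U₁.w = U₂.w) (hlt : U₁.rho < U₂.rho) (hQ : M.Q U₂.rho U₂.w < M.Q U₁.rho U₁.w) :
    M.IsCongested U₂ := by
  refine ⟨h₂, fun y hy hlt' => ?_⟩
  rw [hw] at h₁ hQ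
  have := (Q_strictConcaveOn h₂.1).slope_anti_adjacent h₁.2 hy.2 hlt hlt'
  have hneg : (M.Q U₂.rho U₂.w - M.Q U₁.rho U₂.w) / (U₂.rho - U₁.rho) < 0 :=
    div_neg_of_neg_of_pos (sub_neg.2 hQ) (sub_pos.2 hlt)
  have := (div_lt_iff₀ (sub_pos.2 hlt')).1 (this.trans hneg)
  linarith

/-- The flux estimate. Let `U₀` be congested, and let `(U₁, U₂)` be a rarefaction whose right state
has the same velocity as `U₀`. At the attribute of `U₀` the flux variation between the velocities
of `U₁` and `U₂` is negative, and changing the attribute back costs at most `C_* / 2` times the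
difference of the attributes, since both endpoint corrections have the same sign. -/
lemma IsCongested.flux_sub_lt {U₀ U₁ U₂ : TState} (h₀ : M.IsCongested U₀)
    (h₁ : M.Dom U₁.rho U₁.w) (h₂ : M.Dom U₂.rho U₂.w) (hw : U₁.w = U₂.w)
    (hlt : U₂.rho < U₁.rho) (hV : M.V U₂.rho U₂.w = M.V U₀.rho U₀.w) :
    M.Q U₁.rho U₁.w - M.Q U₂.rho U₂.w < M.Cstar / 2 * |U₁.w - U₀.w| := by
  obtain ⟨ρ₀, w₀⟩ := U₀
  obtain ⟨ρ₁, w₁⟩ := U₁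
  obtain ⟨ρ₂, w₂⟩ := U₂
  obtain ⟨h₀, hdec⟩ := h₀
  dsimp only at *
  subst hw
  have hV12 : M.V ρ₁ w₁ < M.V ρ₂ w₁ := V_strictAntiOn h₁.1 h₂.2 h₁.2 hlt
  obtain ⟨r, hr, hle, hrV⟩ := exists_V_eq h₀ ⟨h₁.V_nonneg, hV ▸ hV12.le⟩
  have hne : ρ₀ ≠ r := by
    rintro rfl
    exact hV12.ne (hrV.symm.trans hV.symm)
  have hQ := hdec r hr (lt_of_le_of_ne hle hne)
  unfold Q at hQ ⊢
  rw [hrV] at hQ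
  rw [← hV] at hQ
  rcases le_total w₀ w₁ with hle | hle
  · rw [abs_of_nonneg (sub_nonneg.2 hle)]
    have a := (flux_sub_mem_Icc hr h₁ hle hrV).2
    have c := (flux_sub_mem_Icc h₀ h₂ hle hV.symm).1
    linarith
  · rw [abs_of_nonpos (sub_nonpos.2 hle)]
    have a := (flux_sub_mem_Icc h₁ hr hle hrV.symm).1
    have c := (flux_sub_mem_Icc h₂ h₀ hle hV).2
    rw [hrV] at a
    rw [← hV] at c
    linarith

/-! ### Speeds of fronts -/

lemma IsFront.speed_le {S : Wave} (h : M.IsFront S) :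
    S.speed ≤ M.V S.right.rho S.right.w := by
  obtain ⟨hl, hr, ⟨hs, heq⟩ | ⟨-, -, hle⟩ | ⟨-, hV, heq⟩⟩ := h
  · have hw : S.left.w = S.right.w := hs.1
    have hlt := hs.2
    rw [heq, div_le_iff₀ (sub_pos.2 hlt), hw]
    rw [hw] at hl
    have hV : M.V S.right.rho S.right.w < M.V S.left.rho S.right.w :=
      V_strictAntiOn hr.1 hl.2 hr.2 hlt
    have := mul_le_mul_of_nonneg_left hV.le hl.2.1
    unfold Q
    linarith
  · refine hle.trans ?_
    have := mul_nonneg_of_nonpos_of_nonpos (neg_nonpos.2 hr.2.1) hr.Vrho_neg.le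
    rw [lam1]
    linarith
  · rw [heq, hV]

/-- A front that is caught up by its left neighbour is a `ρ`-wave: nothing moves faster than the
velocity `V` of its right state, which is the speed of a `w`-wave next to it. -/
lemma IsFront.isRho_of_speed_lt {f g : Wave} (hf : M.IsFront f) (hg : M.IsFront g)
    (hfg : g.left = f.right) (h : g.speed < f.speed) : g.IsRho := by
  obtain ⟨-, -, ⟨hs, -⟩ | ⟨hs, -⟩ | ⟨-, -, heq⟩⟩ := hg
  · exact hs.1
  · exact hs.1
  · rw [heq, hfg] at h
    exact absurd hf.speed_le (not_le.2 h)

lemma IsFront.isShock_or_isRarefaction {S : Wave} (h : M.IsFront S) (hS : S.IsRho) :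
    S.IsShock ∨ S.IsRarefaction := by
  obtain ⟨-, -, h | h | h⟩ := h
  · exact .inl h.1
  · exact .inr h.1
  · exact absurd hS h.1

lemma IsFront.flux_sub_eq {S : Wave} (h : M.IsFront S) (hS : S.IsShock) :
    M.Q S.right.rho S.right.w - M.Q S.left.rho S.left.w =
      S.speed * (S.right.rho - S.left.rho) := by
  have hne := (sub_pos.2 hS.2).ne'
  obtain ⟨-, -, ⟨-, heq⟩ | ⟨hr, -⟩ | ⟨hw, -⟩⟩ := h
  · rw [heq, div_mul_cancel₀ _ hne]
  · exact absurd hr.2 hS.2.not_gt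
  · exact absurd hS.1 hw

lemma IsEmission.isCongested {U : TState} {b t : ℝ} {es : List Wave} (h : M.IsEmission U b t es)
    {e : Wave} (he : e ∈ es) : M.IsCongested e.right := by
  obtain ⟨-, hall, hcase, -⟩ := h
  obtain ⟨hf, -, hs⟩ := hall e he
  rcases hcase with ⟨e', rfl, hsh⟩ | hr
  · obtain rfl := List.mem_singleton.1 he
    have := hf.flux_sub_eq hsh
    have := mul_neg_of_neg_of_pos hs (sub_pos.2 hsh.2)
    exact isCongested_of_shock hf.1 hf.2.1 hsh.1 hsh.2 (by linarith)
  · exact isCongested_of_lam1_nonpos hf.2.1 (hr e he).2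

end GSOM

/-! ### The line of right mothers -/

namespace Wave

/-- The front through which the line of right mothers of a given front entered the domain. -/
def rightSource : Wave → Wave
  | S@(source _ _ _ _ _ _) => S
  | daughter _ r _ _ _ _ _ => rightSource r

lemma self_mem_tree (S : Wave) : S ∈ S.tree := by
  cases S <;> simp [tree]

lemma mem_tree_daughter {S l r : Wave} {Um Up : TState} {s x t : ℝ} :
    S ∈ (daughter l r Um Up s x t).tree ↔
      S = daughter l r Um Up s x t ∨ S ∈ l.tree ∨ S ∈ r.tree := by
  classical
  rw [tree, Finset.mem_insert, Finset.mem_union]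

lemma tree_subset {R S : Wave} (h : S ∈ R.tree) : S.tree ⊆ R.tree := by
  induction R with
  | source k Um Up s x t =>
    rw [tree, Finset.mem_singleton] at h
    rw [h]
  | daughter l r Um Up s x t ihl ihr =>
    rcases mem_tree_daughter.1 h with rfl | h | h
    · exact subset_rfl
    · exact fun F hF => mem_tree_daughter.2 (.inr (.inl (ihl h hF)))
    · exact fun F hF => mem_tree_daughter.2 (.inr (.inr (ihr h hF)))

lemma mem_tree_daughter_left {l r : Wave} {Um Up : TState} {s x t : ℝ} :
    l ∈ (daughter l r Um Up s x t).tree :=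
  mem_tree_daughter.2 (.inr (.inl l.self_mem_tree))

lemma mem_tree_daughter_right {l r : Wave} {Um Up : TState} {s x t : ℝ} :
    r ∈ (daughter l r Um Up s x t).tree :=
  mem_tree_daughter.2 (.inr (.inr r.self_mem_tree))

lemma InBranch.mem_tree {R S : Wave} (h : R.InBranch S) : S ∈ R.tree := by
  induction h with
  | refl => exact R.self_mem_tree
  | left _ _ ih => exact tree_subset ih mem_tree_daughter_left
  | right _ _ ih => exact tree_subset ih mem_tree_daughter_right

lemma not_fromJunction_daughter {l r : Wave} {Um Up : TState} {s x t τ : ℝ} :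
    ¬ (daughter l r Um Up s x t).FromJunction τ := by
  rintro ⟨_, _, _, _, h⟩
  cases h

lemma EntersAt.tree_eq {S : Wave} {k : WaveSource} {x t : ℝ} (h : S.EntersAt k x t) :
    S.tree = {S} := by
  obtain ⟨_, _, _, rfl⟩ := h
  rw [tree]

lemma EntersAt.rightSource_eq {S : Wave} {k : WaveSource} {x t : ℝ} (h : S.EntersAt k x t) :
    S.rightSource = S := by
  obtain ⟨_, _, _, rfl⟩ := h
  rfl

lemma EntersAt.birthTime_eq {S : Wave} {k : WaveSource} {x t : ℝ} (h : S.EntersAt k x t) :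
    S.birthTime = t := by
  obtain ⟨_, _, _, rfl⟩ := h
  rfl

lemma EntersAt.unique {S : Wave} {k k' : WaveSource} {x x' t t' : ℝ} (h : S.EntersAt k x t)
    (h' : S.EntersAt k' x' t') : k = k' ∧ x = x' ∧ t = t' := by
  obtain ⟨_, _, _, rfl⟩ := h
  obtain ⟨_, _, _, h'⟩ := h'
  cases h'
  exact ⟨rfl, rfl, rfl⟩

lemma EntersAt.fromJunction {S : Wave} {x t : ℝ} (h : S.EntersAt .junction x t) :
    S.FromJunction t := ⟨x, h⟩

/-- What wave-front tracking guarantees along the line of right mothers of a front: all right mothers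
are `ρ`-waves adjacent to their left sisters, a daughter takes over the attribute on the left of its
left mother and the velocity on the right of its right mother, and a line that starts at the
junction starts there with a congested right state and strictly before all its interactions. (The
attribute `Um.w` is that of `l.left` also for an outgoing `w`-wave, whose left state is the middle
state of the Riemann problem.) -/
def RightHistory (M : GSOM) : Wave → Prop
  | source k _ Up _ _ _ => k = .junction → M.IsCongested Up
  | daughter l r Um Up _ _ t => RightHistory M r ∧ r.IsRho ∧ r.left = l.right ∧ Um.w = l.left.w ∧
      M.V Up.rho Up.w = M.V r.right.rho r.right.w ∧
      ∀ τ, r.rightSource.FromJunction τ → τ < t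

lemma one_le_level (S : Wave) (t₀ : ℝ) : 1 ≤ S.level t₀ := by
  induction S with
  | source => exact le_rfl
  | daughter => rw [level]; split_ifs <;> omega

namespace RightHistory

variable {M : GSOM} {S : Wave}

lemma V_right (h : S.RightHistory M) : M.V S.right.rho S.right.w =
    M.V S.rightSource.right.rho S.rightSource.right.w := by
  induction S with
  | source => rfl
  | daughter l r Um Up s x t _ ih =>
    obtain ⟨hr, -, -, -, hV, -⟩ := h
    exact hV.trans (ih hr)

lemma isCongested (h : S.RightHistory M) {τ : ℝ} (hτ : S.rightSource.FromJunction τ) :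
    M.IsCongested S.rightSource.right := by
  induction S with
  | source k Um Up s x t =>
    obtain ⟨y, hy⟩ := hτ
    exact h (EntersAt.unique ⟨Um, Up, s, rfl⟩ hy).1
  | daughter l r Um Up s x t _ ih => exact ih h.1 hτ

lemma isRho_rightSource (h : S.RightHistory M) (hS : S.IsRho) : S.rightSource.IsRho := by
  induction S with
  | source => exact hS
  | daughter l r Um Up s x t _ ih => exact ih h.1 h.2.1

lemma inBranch_rightSource {R : Wave} (h : S.RightHistory M) (hR : R.IsRho)
    (hRS : R.InBranch S) : R.InBranch S.rightSource := by
  induction S with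
  | source => exact hRS
  | daughter l r Um Up s x t _ ih => exact ih h.1 (hRS.right (iff_of_true h.2.1 hR))

lemma left_w_eq_of_tree (h : S.RightHistory M) (hS : ∀ F ∈ S.tree, F.IsRho) :
    S.left.w = S.rightSource.left.w := by
  induction S with
  | source => rfl
  | daughter l r Um Up s x t _ ih =>
    obtain ⟨hr, -, hlr, hw, -⟩ := h
    have hl : l.left.w = l.right.w := hS _ mem_tree_daughter_left
    calc Um.w = r.left.w := by rw [hw, hl, hlr]
      _ = _ := ih hr fun F hF => hS F (tree_subset mem_tree_daughter_right hF)

lemma left_w_eq_of_level_le (h : S.RightHistory M) {t₀ : ℝ}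
    (hτ : S.rightSource.FromJunction t₀) (hl : S.level t₀ ≤ 1) :
    S.left.w = S.rightSource.left.w := by
  induction S with
  | source => rfl
  | daughter l r Um Up s x t _ ih =>
    obtain ⟨hr, hrρ, hlr, hw, -, ht⟩ := h
    have hpos := r.one_le_level t₀
    rw [level, if_neg (ht _ hτ).not_ge] at hl
    by_cases hlρ : l.IsRho
    · rw [if_neg (not_not.2 hlρ), if_neg (not_not.2 hrρ)] at hl
      calc Um.w = r.left.w := by rw [hw, show l.left.w = l.right.w from hlρ, hlr]
        _ = _ := ih hr hτ ((le_max_right _ _).trans hl)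
    · rw [if_pos hlρ] at hl
      omega

/-- If the line of right mothers enters from the junction at time `t₀`, then `w¹` is the attribute
with which it enters. -/
lemma levelW_one (h : S.RightHistory M) {t₀ : ℝ}
    (hτ : S.rightSource.FromJunction t₀) : S.levelW t₀ 1 = S.rightSource.left.w := by
  induction S with
  | source => rfl
  | daughter l r Um Up s x t _ ih =>
    obtain ⟨hr, -, -, -, -, ht⟩ := id h
    rw [levelW]
    split_ifs with hc
    · exact h.left_w_eq_of_level_le hτ (hc.resolve_left (ht _ hτ).not_ge)
    · exact ih hr hτ

end RightHistory

lemma levelW_of_level_le {S : Wave} {t₀ : ℝ} {k : ℕ} (h : S.level t₀ ≤ k) :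
    S.levelW t₀ k = S.left.w := by
  cases S with
  | source => rfl
  | daughter => rw [levelW, if_pos (.inr h)]; rfl

lemma level_le_order (S : Wave) (t₀ : ℝ) : S.level t₀ ≤ S.order t₀ :=
  Finset.le_sup (f := level t₀) S.self_mem_tree

lemma abs_sub_le_sum_Icc (u : ℕ → ℝ) {n : ℕ} (hn : 1 ≤ n) :
    |u n - u 1| ≤ ∑ k ∈ Finset.Icc 2 n, |u k - u (k - 1)| := by
  induction n, hn using Nat.le_induction with
  | base => simp
  | succ n hn ih =>
    rw [Finset.sum_Icc_succ_top (by omega), Nat.add_sub_cancel]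
    linarith [abs_sub_le (u (n + 1)) (u n) (u 1)]

lemma RightHistory.abs_sub_le_TVtree {M : GSOM} {S : Wave} (h : S.RightHistory M)
    {t₀ : ℝ} (hτ : S.rightSource.FromJunction t₀) :
    |S.left.w - S.rightSource.left.w| ≤ S.TVtree t₀ := by
  have := abs_sub_le_sum_Icc (S.levelW t₀) ((S.one_le_level t₀).trans (S.level_le_order t₀))
  rwa [levelW_of_level_le (S.level_le_order t₀), h.levelW_one hτ] at this

/-! ### Invariants of wave-front tracking -/

lemma linked_append {U : TState} {fs gs : List Wave} :
    Linked U (fs ++ gs) ↔ Linked U fs ∧ Linked (endState U fs) gs := by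
  induction fs generalizing U with
  | nil => simp [Linked, endState]
  | cons f fs ih => simp [Linked, endState, ih, and_assoc]

/-- Every front of the tree of `f` that was emitted by the junction was emitted no later than the
line of right mothers of `g`, which comes from the junction too. -/
def EmittedBefore (f g : Wave) : Prop :=
  ∀ S ∈ f.tree, ∀ τ, S.FromJunction τ → ∃ τ', τ ≤ τ' ∧ g.rightSource.FromJunction τ'

lemma EmittedBefore.daughter_left {f g h : Wave} {Um Up : TState} {s x t : ℝ}
    (hf : f.EmittedBefore h) (hg : g.EmittedBefore h) :
    (daughter f g Um Up s x t).EmittedBefore h := by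
  intro S hS τ hτ
  rcases mem_tree_daughter.1 hS with rfl | hS | hS
  · exact absurd hτ not_fromJunction_daughter
  · exact hf S hS τ hτ
  · exact hg S hS τ hτ

lemma EmittedBefore.of_entersAt {f g : Wave} {k : WaveSource} {x t : ℝ} (hk : k ≠ .junction)
    (h : f.EntersAt k x t) : f.EmittedBefore g := by
  intro S hS τ ⟨y, hy⟩
  rw [h.tree_eq, Finset.mem_singleton] at hS
  subst hS
  exact absurd (h.unique hy).1 hk

lemma RightHistory.of_entersAt {M : GSOM} {f : Wave} {k : WaveSource} {x t : ℝ}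
    (hk : k ≠ .junction) (h : f.EntersAt k x t) : f.RightHistory M := by
  obtain ⟨_, _, _, rfl⟩ := h
  exact fun h' => absurd h' hk

end Wave

namespace GSOM

open Wave

variable {M : GSOM}

lemma exists_of_mem_outgoing {f g e : Wave} {Us : TState} {s₁ s₂ x t : ℝ}
    (h : e ∈ outgoing f g Us s₁ s₂ x t) : ∃ Um Up s, e = daughter f g Um Up s x t ∧
      ((Um = f.left ∧ Up = Us) ∨ (Um = Us ∧ Up = g.right)) := by
  rw [outgoing, List.mem_append] at h
  rcases h with h | h <;> split_ifs at h
  · cases h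
  · exact ⟨_, _, _, List.mem_singleton.1 h, .inl ⟨rfl, rfl⟩⟩
  · cases h
  · exact ⟨_, _, _, List.mem_singleton.1 h, .inr ⟨rfl, rfl⟩⟩

lemma linked_outgoing (f g : Wave) (Us : TState) (s₁ s₂ x t : ℝ) :
    Linked f.left (outgoing f g Us s₁ s₂ x t) ∧
      endState f.left (outgoing f g Us s₁ s₂ x t) = g.right := by
  unfold outgoing
  split_ifs with h₁ h₂ h₂ <;> simp_all [Linked, endState, Wave.left, Wave.right]

/-- The properties of a front that hold at time `t` of wave-front tracking, independently of the
other fronts. -/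
structure FrontInvariant (M : GSOM) (b t : ℝ) (f : Wave) : Prop where
  isFront : M.IsFront f
  history : f.RightHistory M
  emittedBefore : f.EmittedBefore f
  birthTime_le : f.birthTime ≤ t
  emission_le : ∀ S ∈ f.tree, ∀ τ, S.FromJunction τ → τ ≤ t
  birthPos_eq : ∀ x τ, f.EntersAt .junction x τ → x = b

lemma FrontInvariant.mono {b t t' : ℝ} {f : Wave} (h : M.FrontInvariant b t f) (ht : t ≤ t') :
    M.FrontInvariant b t' f :=
  ⟨h.isFront, h.history, h.emittedBefore, h.birthTime_le.trans ht,
    fun S hS τ hτ => (h.emission_le S hS τ hτ).trans ht, h.birthPos_eq⟩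

lemma FrontInvariant.of_entersAt {b t x : ℝ} {f : Wave} {k : WaveSource} (hk : k ≠ .junction)
    (hf : M.IsFront f) (h : f.EntersAt k x t) : M.FrontInvariant b t f where
  isFront := hf
  history := .of_entersAt hk h
  emittedBefore := .of_entersAt hk h
  birthTime_le := h.birthTime_eq.le
  emission_le := by
    intro S hS τ ⟨y, hy⟩
    rw [h.tree_eq, Finset.mem_singleton] at hS
    subst hS
    exact absurd (h.unique hy).1 hk
  birthPos_eq := fun _ _ hy => absurd (h.unique hy).1 hk

lemma FrontInvariant.of_emission {U : TState} {b t : ℝ} {es : List Wave}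
    (h : M.IsEmission U b t es) {e : Wave} (he : e ∈ es) : M.FrontInvariant b t e := by
  obtain ⟨hf, hent, -⟩ := h.2.1 e he
  have hc := h.isCongested he
  refine ⟨hf, ?_, ?_, hent.birthTime_eq.le, ?_, fun _ _ hy => (hent.unique hy).2.1.symm⟩
  · obtain ⟨_, _, _, rfl⟩ := hent
    exact fun _ => hc
  · rintro S hS τ hτ
    rw [hent.tree_eq, Finset.mem_singleton] at hS
    subst hS
    exact ⟨τ, le_rfl, hent.rightSource_eq.symm ▸ hτ⟩
  · rintro S hS τ ⟨y, hy⟩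
    rw [hent.tree_eq, Finset.mem_singleton] at hS
    subst hS
    exact (hent.unique hy).2.2.ge

/-- If the line of right mothers of `g` comes from the junction, it was emitted strictly before `g`
interacts inside the road: a front that has just been emitted is still at the junction. -/
lemma FrontInvariant.emission_lt {b t t' : ℝ} {g : Wave} (h : M.FrontInvariant b t g)
    (ht : t ≤ t') (hpos : g.pos t' < b) {τ : ℝ} (hτ : g.rightSource.FromJunction τ) : τ < t' := by
  have hbirth := h.birthTime_le
  cases g with
  | source k Um Up s x₀ t₀ =>
    obtain ⟨y, hy⟩ := hτ
    obtain ⟨rfl, -, rfl⟩ := EntersAt.unique ⟨Um, Up, s, rfl⟩ hy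
    obtain rfl := h.birthPos_eq x₀ t₀ ⟨Um, Up, s, rfl⟩
    refine lt_of_le_of_ne (hbirth.trans ht) ?_
    rintro rfl
    simp [pos, birthPos, birthTime] at hpos
  | daughter l r Um Up s x₀ t₀ =>
    obtain ⟨-, -, -, -, -, hlt⟩ := h.history
    exact (hlt τ hτ).trans_le (hbirth.trans ht)

lemma FrontInvariant.of_outgoing {b t t' x : ℝ} {f g e : Wave} {Us : TState} {s₁ s₂ : ℝ}
    (hf : M.FrontInvariant b t f) (hg : M.FrontInvariant b t g) (hfg : f.EmittedBefore g)
    (hlink : g.left = f.right) (ht : t ≤ t') (hpos : g.pos t' < b) (hspeed : g.speed < f.speed)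
    (hw : Us.w = f.left.w) (hV : M.V Us.rho Us.w = M.V g.right.rho g.right.w)
    (he : e ∈ outgoing f g Us s₁ s₂ x t') (hfront : M.IsFront e) : M.FrontInvariant b t' e := by
  have hgrho := hf.isFront.isRho_of_speed_lt hg.isFront hlink hspeed
  obtain ⟨Um, Up, s, rfl, hU⟩ := exists_of_mem_outgoing he
  refine ⟨hfront, ⟨hg.history, hgrho, hlink, ?_, ?_, fun τ hτ => hg.emission_lt ht hpos hτ⟩,
    ?_, le_rfl, ?_, fun y τ hy => ?_⟩
  · rcases hU with ⟨rfl, -⟩ | ⟨rfl, -⟩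
    · rfl
    · exact hw
  · rcases hU with ⟨-, rfl⟩ | ⟨-, rfl⟩
    · exact hV
    · rfl
  · exact .daughter_left (h := daughter f g Um Up s x t') hfg hg.emittedBefore
  · intro S hS τ hτ
    rcases mem_tree_daughter.1 hS with rfl | hS | hS
    · exact absurd hτ not_fromJunction_daughter
    · exact (hf.emission_le S hS τ hτ).trans ht
    · exact (hg.emission_le S hS τ hτ).trans ht
  · exact absurd hy.fromJunction not_fromJunction_daughter

/-- The fronts are linked, each one has the properties above, and emissions from the junction are
ordered in time: the further to the right, the later. The last property is what identifies the
original time of a returning wave with the emission time of its line of right mothers. -/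
lemma Tracking.invariant {a : EReal} {b t : ℝ} {U₀ : TState} {ws : List Wave}
    (h : M.Tracking a b t U₀ ws) :
    Linked U₀ ws ∧ (∀ f ∈ ws, M.FrontInvariant b t f) ∧ ws.Pairwise EmittedBefore := by
  induction h with
  | start U₀ ws hU hlink hws hord =>
    refine ⟨hlink, fun f hf => ?_, List.pairwise_of_forall_mem_list fun f hf g _ => ?_⟩
    · obtain ⟨hfr, x, -, -, hx⟩ := hws f hf
      exact .of_entersAt (by simp) hfr hx
    · obtain ⟨-, x, -, -, hx⟩ := hws f hf
      exact .of_entersAt (by simp) hx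
  | @interaction t U₀ pre post f g h t' x ht hord hax hxb hf hg hspeed hother Us s₁ s₂ hUs hw hV
      hout ih =>
    obtain ⟨hlink, hinv, hpair⟩ := ih
    have hfi := hinv f (by simp)
    have hgi := hinv g (by simp)
    simp only [linked_append, Linked] at hlink
    obtain ⟨hpre, hfl, hgl, hpost⟩ := hlink
    simp only [List.pairwise_append, List.pairwise_cons, List.mem_cons, forall_eq_or_imp]
      at hpair
    obtain ⟨hppre, ⟨⟨hfg, hfpost⟩, hgpost, hppost⟩, hcross⟩ := hpair
    obtain ⟨hol, hoe⟩ := linked_outgoing f g Us s₁ s₂ x t'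
    refine ⟨?_, fun e he => ?_, ?_⟩
    · rw [List.append_assoc, linked_append, linked_append, ← hfl, hoe]
      exact ⟨hpre, hol, hpost⟩
    · rw [List.mem_append, List.mem_append] at he
      rcases he with (he | he) | he
      · exact (hinv e (by simp [he])).mono ht
      · exact hfi.of_outgoing hgi hfg hgl ht (hg ▸ hxb) hspeed hw hV he (hout e he)
      · exact (hinv e (by simp [he])).mono ht
    · rw [List.append_assoc, List.pairwise_append, List.pairwise_append]
      refine ⟨hppre, ⟨List.pairwise_of_forall_mem_list fun d hd e he => ?_, hppost,
        fun d hd e he => ?_⟩, fun d hd e he => ?_⟩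
      · obtain ⟨_, _, _, rfl, -⟩ := exists_of_mem_outgoing hd
        obtain ⟨_, _, _, rfl, -⟩ := exists_of_mem_outgoing he
        exact .daughter_left (h := daughter f g _ _ _ x t') hfg hgi.emittedBefore
      · obtain ⟨_, _, _, rfl, -⟩ := exists_of_mem_outgoing hd
        exact .daughter_left (hfpost e he) (hgpost e he)
      · rcases List.mem_append.1 he with he | he
        · obtain ⟨_, _, _, rfl, -⟩ := exists_of_mem_outgoing he
          exact (hcross d hd).2.1
        · exact (hcross d hd).2.2 e he
  | @junction t U₀ ws arr h t' ht hord harr es hes ih =>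
    obtain ⟨hlink, hinv, hpair⟩ := ih
    rw [linked_append] at hlink
    have hall : ∀ e ∈ ws ++ es, M.FrontInvariant b t' e := fun e he => by
      rcases List.mem_append.1 he with he | he
      · exact (hinv e (by simp [he])).mono ht
      · exact .of_emission hes he
    have hlate : ∀ f ∈ ws ++ es, ∀ e ∈ es, f.EmittedBefore e := fun f hf e he S hS τ hτ => by
      have hent := (hes.2.1 e he).2.1
      exact ⟨t', (hall f hf).emission_le S hS τ hτ, hent.rightSource_eq.symm ▸ hent.fromJunction⟩
    exact ⟨linked_append.2 ⟨hlink.1, hes.1⟩, hall, List.pairwise_append.2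
      ⟨(List.pairwise_append.1 hpair).1,
        List.pairwise_of_forall_mem_list fun f hf e he => hlate f (by simp [hf]) e he,
        fun f hf e he => hlate f (by simp [hf]) e he⟩⟩
  | @inflow t U₀ dep ws h t' x ht hord hx hdep U₁ ins hU₁ hlink' hend hins hspeed ih =>
    obtain ⟨hlink, hinv, hpair⟩ := ih
    rw [linked_append, ← hend] at hlink
    refine ⟨linked_append.2 ⟨hlink', hlink.2⟩, fun e he => ?_, List.pairwise_append.2
      ⟨List.pairwise_of_forall_mem_list fun f hf g _ => ?_, (List.pairwise_append.1 hpair).2.1,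
        fun f hf g _ => ?_⟩⟩
    · rcases List.mem_append.1 he with he | he
      · exact .of_entersAt (by simp) (hins e he).1 (hins e he).2.1
      · exact (hinv e (by simp [he])).mono ht
    · exact .of_entersAt (by simp) (hins f hf).2.1
    · exact .of_entersAt (by simp) (hins f hf).2.1

/-! ### Returning waves -/

/-- The line of right mothers of a returning `ρ`-wave enters from the junction exactly at the
original time. -/
lemma IsReturningWave.rightSource {a : EReal} {b t_o t_a : ℝ} {R : Wave}
    (h : M.IsReturningWave a b R t_o t_a) (hR : R.IsRho) :
    M.IsFront R ∧ R.RightHistory M ∧ R.rightSource.FromJunction t_o := by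
  obtain ⟨⟨t, U₀, ws, htr, -⟩, -, ⟨S, hS, hSt⟩, hmax⟩ := h
  obtain ⟨-, hinv, -⟩ := htr.invariant
  have hi := hinv R (by simp)
  obtain ⟨τ, hle, hτ⟩ := hi.emittedBefore S hS.mem_tree t_o hSt
  have hτle := hmax ⟨_, hi.history.inBranch_rightSource hR .refl, hτ⟩
  obtain rfl : t_o = τ := le_antisymm hle hτle
  exact ⟨hi.isFront, hi.history, hτ⟩

/-- A returning rarefaction has `δ₋Q < (C_* / 2) |w - w₀|`, where `w₀` is the attribute with which
its line of right mothers was emitted. -/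
lemma IsReturningWave.dQminus_lt {a : EReal} {b t_o t_a : ℝ} {R : Wave}
    (h : M.IsReturningWave a b R t_o t_a) (hR : R.IsRarefaction) :
    M.dQminus R < M.Cstar / 2 * |R.left.w - R.rightSource.left.w| := by
  obtain ⟨hf, hh, hτ⟩ := h.rightSource hR.1
  rw [show R.rightSource.left.w = R.rightSource.right.w from hh.isRho_rightSource hR.1]
  exact (hh.isCongested hτ).flux_sub_lt hf.1 hf.2.1 hR.1 hR.2 hh.V_right

end GSOM

theorem mainTheorem5 (M : GSOM) (a : EReal) (b : ℝ) (hab : a < (b : EReal))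
    (R : Wave) (t_o t_a : ℝ) (hR : M.IsReturningWave a b R t_o t_a)
    (hw : R.left.w = R.right.w) :
    -- a shock, or a rarefaction with `ρ̃⁻ < ρ⁺ < σ < ρ⁻`, or a tree with only `ρ`-waves
    ((R.IsShock ∨
        (R.IsRarefaction ∧ ∃ ρt ∈ Set.Icc 0 (M.rhoMax R.left.w),
          M.Q ρt R.left.w = M.Q R.left.rho R.left.w ∧
          ρt < R.right.rho ∧ R.right.rho < M.sigma R.left.w ∧ M.sigma R.left.w < R.left.rho) ∨
        (∀ S ∈ R.tree, S.IsRho)) →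
      M.dQminus R < 0) ∧
    -- a rarefaction with `ρ⁺ < ρ̃⁻ < σ < ρ⁻` generated by a `w`-wave and a `ρ`-wave from the junction
    (∀ (Sl Sr : Wave) (Um Up : TState) (s x t ρt : ℝ),
      R = Wave.daughter Sl Sr Um Up s x t →
      ¬ Sl.IsRho → Sr.IsRho → Sr.FromJunction t_o →
      R.IsRarefaction →
      ρt ∈ Set.Icc 0 (M.rhoMax R.left.w) →
      M.Q ρt R.left.w = M.Q R.left.rho R.left.w →
      R.right.rho < ρt → ρt < M.sigma R.left.w → M.sigma R.left.w < R.left.rho →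
      0 < M.dQminus R ∧ M.dQminus R < M.Cstar * |Sl.right.w - Sl.left.w|) ∧
    -- the general case
    (R.IsRarefaction → 0 < M.dQminus R →
      M.dQminus R ≤ M.Cstar * R.TVtree t_o + ∑ S ∈ R.levelOne t_o, max (M.dQminus S) 0) := by
  have hRho : R.IsRho := hw
  obtain ⟨hf, hh, hτ⟩ := hR.rightSource hRho
  have hC := GSOM.Cstar_nonneg (M := M)
  have hspeed : 0 < R.speed := by
    obtain ⟨⟨_, _, _, _, _, _, _, h⟩, -⟩ := hR
    exact h
  have hshock : R.IsShock → M.dQminus R < 0 := fun hs => by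
    have := hf.flux_sub_eq hs
    have := mul_pos hspeed (sub_pos.2 hs.2)
    rw [GSOM.dQminus]
    linarith
  refine ⟨?_, ?_, ?_⟩
  · rintro (hs | ⟨-, ρt, hρt, hQ, h₁, h₂, -⟩ | htree)
    · exact hshock hs
    · have := GSOM.Q_lt_of_lt_sigma ⟨hf.1.1, hρt⟩ h₁ h₂
      rw [GSOM.dQminus, ← hw]
      linarith
    · rcases hf.isShock_or_isRarefaction hRho with hs | hr
      · exact hshock hs
      · simpa [hh.left_w_eq_of_tree htree] using hR.dQminus_lt hr
  · rintro Sl Sr Um Up s x t ρt hRd - - hSr hr hρt hQ h₁ h₂ -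
    -- `Sr` enters from the junction, so it is the end of the line of right mothers.
    have hsrc : Sr.rightSource = Sr := hSr.choose_spec.rightSource_eq
    obtain ⟨-, -, hlink, hUm, -⟩ := show (Wave.daughter Sl Sr Um Up s x t).RightHistory M from
      hRd ▸ hh
    have hpos : M.Q R.right.rho R.right.w < M.Q R.left.rho R.left.w := by
      have := GSOM.Q_lt_of_lt_sigma (M := M) ⟨hf.1.1, hw ▸ hf.2.1.2⟩ h₁ h₂
      rwa [← hw, ← hQ]
    have hlt := hR.dQminus_lt hr
    have hjump : |R.left.w - R.rightSource.left.w| = |Sl.right.w - Sl.left.w| := by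
      rw [hRd]
      change |Um.w - Sr.rightSource.left.w| = _
      rw [hsrc, hlink, hUm, abs_sub_comm]
    rw [hjump] at hlt
    have := mul_nonneg hC (abs_nonneg (Sl.right.w - Sl.left.w))
    exact ⟨sub_pos.2 hpos, by linarith⟩
  · intro hr _
    have h₁ := hR.dQminus_lt hr
    have h₂ := mul_le_mul_of_nonneg_left (hh.abs_sub_le_TVtree hτ) hC
    have h₃ : 0 ≤ M.Cstar * |R.left.w - R.rightSource.left.w| := mul_nonneg hC (abs_nonneg _)
    have h₄ : 0 ≤ ∑ S ∈ R.levelOne t_o, max (M.dQminus S) 0 :=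
      Finset.sum_nonneg fun S _ => le_max_right _ _
    linarith
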